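/- Let $P$ be a unital subsemigroup of a (discrete) group $G$. For $p_1,q_1,\dots,p_n,q_n\in P$ let $p_1^{-1}q_1\cdots p_n^{-1}q_nP\subseteq P$ be the right ideal obtained from $P$ by successively applying $X\mapsto qX=\{qx : x\in X\}$ and $X\mapsto p^{-1}X=\{y\in P : py\in X\}$, and let $\mathcal J$ be the set of all these ideals together with $\emptyset$. An isometric representation of $P$ in a unital C*-algebra is a family of isometries $(T_p)_{p\in P}$ with $T_pT_q=T_{pq}$. Let $\mathrm C^*_{\rm iso}(P)$ be the universal C*-algebra generated by isometries $\mathfrak v_p$, $p\in P$, with $\mathfrak v_p\mathfrak v_q=\mathfrak v_{pq}$. Let $\mathrm C^*_s(P)$ be the universal C*-algebra generated by isometries $v_p$, $p\in P$, and projections $e_{\mathbf x}$, $\mathbf x\in\mathcal J$, subject to: $v_{pq}=v_pv_q$; $e_\emptyset=0$; and $v_{p_1}^*v_{q_1}\cdots v_{p_n}^*v_{q_n}=e_{\mathbf x}$ with $\mathbf x=q_n^{-1}p_n\cdots q_1^{-1}p_1P$ whenever $p_1^{-1}q_1\cdots p_n^{-1}q_n=e$ in $G$. An isometric representation $T$ is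 called constructible if there is a unital $*$-homomorphism on $\mathrm C^*_s(P)$ with $v_p\mapsto T_p$ for all $p\in P$. Let $[\mathrm C^*_{\rm iso}(P)]_e$ be the closed linear span of the elements $\mathfrak v_{p_1}^*\mathfrak v_{q_1}\cdots \mathfrak v_{p_n}^*\mathfrak v_{q_n}$ with $p_1^{-1}q_1\cdots p_n^{-1}q_n=e$ in $G$ (the fixed point algebra of the canonical coaction of $G$). For a finite set $F\subseteq G$ let $X_F\subseteq\ell^2(P)$ be the closed span of the $\delta_r$, $r\in P$, such that for every $g\in F$ either $rP\cap gP=\emptyset$ or $r\in rP\cap gP$. Let $X_F^+=\bigoplus_{g\in G}X_{gF}$ (the $\ell^2$-direct sum), let $V_{F,p}$ be the isometry of $X_F^+$ that maps $\delta_r\in X_{gF}$ to $\delta_{pr}\in X_{pgF}$, let $\Phi_F$ be the representation of $\mathrm C^*_{\rm iso}(P)$ on $X_F^+$ with $\mathfrak v_p\mapsto V_{F,p}$, let $Q_{e,F}$ be the projection of $X_F^+$ onto the summand $X_F$ at $g=e$, and put $\|f\|_F=\|Q_{e,F}\Phi_F(f)Q_{e,F}\|$. Let $$\mathcal I_e=\{f\in[\mathrm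 C^*_{\rm iso}(P)]_e : \lim_F\|f\|_F=0\},$$ where the limit is along the finite subsets $F$ of $G$ directed by inclusion. An isometric representation $T$ is called strongly covariant if the induced $*$-homomorphism on $\mathrm C^*_{\rm iso}(P)$, $\mathfrak v_p\mapsto T_p$, vanishes on $\mathcal I_e$. Let $\mathrm C^*_{\rm sc}(P)$ (Sehnem's strong covariance algebra) be the universal C*-algebra for the strongly covariant representations, i.e. the universal C*-algebra for the representations of $\mathrm C^*_{\rm iso}(P)$ that vanish on $\mathcal I_e$. **Proposition 3.4.** The canonical $*$-homomorphisms $\mathrm C^*_{\rm iso}(P)\to \mathrm C^*_s(P)$ and $\mathrm C^*_{\rm iso}(P)\to \mathrm C^*_{\rm sc}(P)$ are surjective, and the second factors through the first: there is a unique $*$-homomorphism $\pi\colon \mathrm C^*_s(P)\to \mathrm C^*_{\rm sc}(P)$ whose composition with $\mathrm C^*_{\rm iso}(P)\to \mathrm C^*_s(P)$ is the canonical $*$-epimorphism $\mathrm C^*_{\rm iso}(P)\to \mathrm C^*_{\rm sc}(P)$. In other words, strongly covariant representations are constructible: every strongly covariant isometric representation of $P$ in a unital C*-algebra is constructible. 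-/

import Mathlib

open scoped Topology

noncomputable section

universe u v w

namespace SemigroupCStar

/-! ### The free unital `*`-algebra on a set -/

/-- The free unital complex `*`-algebra on `X`: noncommutative polynomials in the letters
`(x, false)` (written `x`) and `(x, true)` (written `x^*`). -/
def FreeStar (X : Type u) : Type u := FreeAlgebra ℂ (X × Bool)

namespace FreeStar

variable {X : Type u}

instance : Ring (FreeStar X) := inferInstanceAs (Ring (FreeAlgebra ℂ (X × Bool)))

instance : Algebra ℂ (FreeStar X) := inferInstanceAs (Algebra ℂ (FreeAlgebra ℂ (X × Bool)))

/-- A letter of the free `*`-algebra. -/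
def letter (x : X × Bool) : FreeStar X := FreeAlgebra.ι ℂ x

/-- The generator `x`. -/
def gen (x : X) : FreeStar X := letter (x, false)

/-- The opposite algebra, with scalars acting through complex conjugation. -/
abbrev twistedAlgebra (X : Type u) : Algebra ℂ (FreeStar X)ᵐᵒᵖ :=
  RingHom.toAlgebra' ((algebraMap ℂ (FreeStar X)ᵐᵒᵖ).comp (starRingEnd ℂ))
    (fun c x => Algebra.commutes (starRingEnd ℂ c) x)

/-- The conjugate-linear anti-homomorphism with `x ↦ x^*` and `x^* ↦ x`. -/
def starHom (X : Type u) : FreeStar X →+* (FreeStar X)ᵐᵒᵖ :=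
  letI := twistedAlgebra X
  (FreeAlgebra.lift ℂ (fun x : X × Bool =>
    MulOpposite.op (letter (x.1, !x.2)))).toRingHom

theorem starHom_letter (x : X × Bool) :
    starHom X (letter x) = MulOpposite.op (letter (x.1, !x.2)) :=
  letI := twistedAlgebra X
  FreeAlgebra.lift_ι_apply (R := ℂ) (A := (FreeStar X)ᵐᵒᵖ) _ x

theorem starHom_algebraMap (c : ℂ) :
    starHom X (algebraMap ℂ _ c) = MulOpposite.op (algebraMap ℂ _ (starRingEnd ℂ c)) :=
  letI := twistedAlgebra X
  AlgHom.commutes (FreeAlgebra.lift ℂ (fun x : X × Bool =>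
    MulOpposite.op (letter (x.1, !x.2)))) c

theorem induction {motive : FreeStar X → Prop}
    (scalar : ∀ c : ℂ, motive (algebraMap ℂ _ c)) (letter : ∀ x, motive (letter x))
    (mul : ∀ a b, motive a → motive b → motive (a * b))
    (add : ∀ a b, motive a → motive b → motive (a + b)) (a : FreeStar X) : motive a :=
  FreeAlgebra.induction ℂ (X × Bool) (motive := motive) scalar letter mul add a

instance : StarRing (FreeStar X) where
  star a := (starHom X a).unop
  star_involutive a := by
    induction a using FreeStar.induction with
    | scalar c => simp [starHom_algebraMap]
    | letter x => simp [starHom_letter]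
    | mul a b ha hb => simp [ha, hb]
    | add a b ha hb => simp [ha, hb]
  star_mul a b := by simp
  star_add a b := by simp

theorem star_letter (x : X × Bool) : star (letter x) = letter (x.1, !x.2) :=
  congrArg MulOpposite.unop (starHom_letter x)

theorem star_algebraMap (c : ℂ) :
    star (algebraMap ℂ (FreeStar X) c) = algebraMap ℂ _ (star c) :=
  congrArg MulOpposite.unop (starHom_algebraMap c)

instance : StarModule ℂ (FreeStar X) where
  star_smul c a := by
    rw [Algebra.smul_def, star_mul, star_algebraMap, Algebra.smul_def, Algebra.commutes]

/-- The `*`-homomorphism determined by the images of the generators. -/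
def lift {B : Type v} [Ring B] [StarRing B] [Algebra ℂ B] [StarModule ℂ B] (f : X → B) :
    FreeStar X →⋆ₐ[ℂ] B where
  __ := (FreeAlgebra.lift ℂ (fun x : X × Bool => if x.2 then star (f x.1) else f x.1) :
      FreeAlgebra ℂ (X × Bool) →ₐ[ℂ] B)
  map_star' a := by
    set φ : FreeStar X →ₐ[ℂ] B :=
      FreeAlgebra.lift ℂ (fun x : X × Bool => if x.2 then star (f x.1) else f x.1) with hφ
    change φ (star a) = star (φ a)
    induction a using FreeStar.induction with
    | scalar c =>
      rw [star_algebraMap, AlgHom.commutes, AlgHom.commutes, algebraMap_star_comm]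
    | letter x =>
      have key : ∀ y : X × Bool, φ (letter y) = if y.2 then star (f y.1) else f y.1 :=
        fun y => FreeAlgebra.lift_ι_apply (R := ℂ) (A := B) _ y
      rw [star_letter, key, key]
      rcases x with ⟨x, _ | _⟩ <;> simp
    | mul a b ha hb => rw [star_mul, map_mul, map_mul, star_mul, ha, hb]
    | add a b ha hb => rw [star_add, map_add, map_add, star_add, ha, hb]

theorem lift_gen {B : Type v} [Ring B] [StarRing B] [Algebra ℂ B] [StarModule ℂ B]
    (f : X → B) (x : X) : lift f (gen x) = f x :=
  (FreeAlgebra.lift_ι_apply (R := ℂ) (A := B) _ (x, false)).trans (by simp)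

end FreeStar

/-! ### The universal C*-algebra of a `*`-algebra with relations -/

section Universal

variable {A : Type u} [Ring A] [StarRing A] [Algebra ℂ A]

/-- C*-seminorms on a complex `*`-algebra. -/
structure CStarSeminorm (A : Type u) [Ring A] [StarRing A] [Algebra ℂ A]
    extends Seminorm ℂ A where
  mul_le' : ∀ a b, toFun (a * b) ≤ toFun a * toFun b
  star_mul_self' : ∀ a, toFun (star a * a) = toFun a * toFun a

namespace CStarSeminorm

instance : CoeFun (CStarSeminorm A) (fun _ => A → ℝ) := ⟨fun p => p.toSeminorm⟩

theorem mul_le (p : CStarSeminorm A) (a b : A) : p (a * b) ≤ p a * p b := p.mul_le' a b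

theorem star_mul_self (p : CStarSeminorm A) (a : A) : p (star a * a) = p a * p a :=
  p.star_mul_self' a

theorem nonneg (p : CStarSeminorm A) (a : A) : 0 ≤ p a := apply_nonneg p.toSeminorm a

theorem add_le (p : CStarSeminorm A) (a b : A) : p (a + b) ≤ p a + p b :=
  map_add_le_add p.toSeminorm a b

theorem smul_eq (p : CStarSeminorm A) (c : ℂ) (a : A) : p (c • a) = ‖c‖ * p a :=
  map_smul_eq_mul p.toSeminorm c a

theorem star_eq (p : CStarSeminorm A) (a : A) : p (star a) = p a := by
  have key : ∀ b : A, p b ≤ p (star b) := by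
    intro b
    rcases (p.nonneg b).eq_or_lt with h | h
    · rw [← h]; exact p.nonneg _
    · have h1 := p.mul_le (star b) b
      rw [p.star_mul_self] at h1
      exact le_of_mul_le_mul_right h1 h
  refine le_antisymm ?_ (key a)
  simpa using key (star a)

theorem one_le_one (p : CStarSeminorm A) : p 1 ≤ 1 := by
  have h : p 1 = p 1 * p 1 := by simpa using p.star_mul_self 1
  nlinarith [p.nonneg 1, sq_nonneg (p 1 - 1)]

theorem le_one_of_isometry (p : CStarSeminorm A) (a : A) (h : p (star a * a - 1) = 0) :
    p a ≤ 1 := by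
  have h1 : p (star a * a) ≤ p (star a * a - 1) + p 1 := by
    simpa using p.add_le (star a * a - 1) 1
  rw [h, p.star_mul_self] at h1
  nlinarith [p.one_le_one, p.nonneg a]

theorem le_one_of_projection (p : CStarSeminorm A) (a : A) (h : p (star a - a) = 0)
    (h' : p (a * a - a) = 0) : p a ≤ 1 := by
  have e : star a * a = (star a - a) * a + ((a * a - a) + a) := by noncomm_ring
  have h1 : p (star a * a) ≤ p a := by
    rw [e]
    refine (p.add_le _ _).trans ?_
    have h2 := p.mul_le (star a - a) a
    have h3 := p.add_le (a * a - a) a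
    rw [h] at h2
    rw [h'] at h3
    linarith
  rw [p.star_mul_self] at h1
  nlinarith [p.nonneg a]

/-- The zero seminorm. -/
def zero (A : Type u) [Ring A] [StarRing A] [Algebra ℂ A] : CStarSeminorm A where
  toSeminorm := 0
  mul_le' a b := by change (0 : ℝ) ≤ 0 * 0; simp
  star_mul_self' a := by change (0 : ℝ) = 0 * 0; simp

theorem zero_apply (a : A) : zero A a = 0 := rfl

/-- The C*-seminorm `a ↦ ‖φ a‖` of a representation `φ`. -/
def ofHom {B : Type v} [CStarAlgebra B] (φ : A →⋆ₐ[ℂ] B) : CStarSeminorm A where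
  toSeminorm := (normSeminorm ℂ B).comp φ.toAlgHom.toLinearMap
  mul_le' a b := by
    change ‖φ (a * b)‖ ≤ ‖φ a‖ * ‖φ b‖
    rw [map_mul]; exact norm_mul_le _ _
  star_mul_self' a := by
    change ‖φ (star a * a)‖ = ‖φ a‖ * ‖φ a‖
    rw [map_mul, map_star, CStarRing.norm_star_mul_self]

theorem ofHom_apply {B : Type v} [CStarAlgebra B] (φ : A →⋆ₐ[ℂ] B) (a : A) :
    ofHom φ a = ‖φ a‖ := rfl

end CStarSeminorm

/-- The C*-seminorms in which all the relators `r ∈ R` vanish. -/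
def Compatible (R : Set A) : Set (CStarSeminorm A) := {p | ∀ r ∈ R, p r = 0}

/-- The relations `R` are bounded: the C*-seminorms compatible with them are pointwise bounded.
This is the condition for the universal C*-algebra of `A` subject to the relations `r = 0`,
`r ∈ R`, to exist. -/
class IsBoundedRel (R : Set A) : Prop where
  bounded : ∀ a : A, ∃ C : ℝ, ∀ p ∈ Compatible R, p a ≤ C

/-- The largest C*-seminorm compatible with `R`. -/
def uSeminorm (R : Set A) (a : A) : ℝ := ⨆ p : Compatible R, p.1 a

instance (R : Set A) : Nonempty (Compatible R) := ⟨⟨CStarSeminorm.zero A, fun _ _ => rfl⟩⟩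

section

variable (R : Set A)

theorem uSeminorm_le {a : A} {C : ℝ} (h : ∀ p ∈ Compatible R, p a ≤ C) : uSeminorm R a ≤ C :=
  ciSup_le fun p => h p.1 p.2

theorem uSeminorm_neg (a : A) : uSeminorm R (-a) = uSeminorm R a := by
  unfold uSeminorm
  congr 1
  funext p
  exact map_neg_eq_map p.1.toSeminorm a

theorem uSeminorm_star (a : A) : uSeminorm R (star a) = uSeminorm R a := by
  unfold uSeminorm
  congr 1
  funext p
  exact p.1.star_eq a

variable [IsBoundedRel R]

theorem le_uSeminorm {p : CStarSeminorm A} (hp : p ∈ Compatible R) (a : A) :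
    p a ≤ uSeminorm R a := by
  obtain ⟨C, hC⟩ := IsBoundedRel.bounded (R := R) a
  exact le_ciSup (f := fun p : Compatible R => p.1 a)
    ⟨C, by rintro _ ⟨p, rfl⟩; exact hC p.1 p.2⟩ ⟨p, hp⟩

theorem uSeminorm_nonneg (a : A) : 0 ≤ uSeminorm R a :=
  le_uSeminorm R (p := CStarSeminorm.zero A) (fun _ _ => rfl) a

theorem uSeminorm_zero : uSeminorm R 0 = 0 := by
  refine le_antisymm (uSeminorm_le R fun p _ => ?_) (uSeminorm_nonneg R 0)
  exact (map_zero p.toSeminorm).le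

theorem uSeminorm_add (a b : A) : uSeminorm R (a + b) ≤ uSeminorm R a + uSeminorm R b :=
  uSeminorm_le R fun p hp =>
    (p.add_le a b).trans (add_le_add (le_uSeminorm R hp a) (le_uSeminorm R hp b))

theorem uSeminorm_smul (c : ℂ) (a : A) : uSeminorm R (c • a) ≤ ‖c‖ * uSeminorm R a :=
  uSeminorm_le R fun p hp => by
    rw [p.smul_eq]
    exact mul_le_mul_of_nonneg_left (le_uSeminorm R hp a) (norm_nonneg c)

theorem uSeminorm_mul (a b : A) : uSeminorm R (a * b) ≤ uSeminorm R a * uSeminorm R b :=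
  uSeminorm_le R fun p hp => (p.mul_le a b).trans
    (mul_le_mul (le_uSeminorm R hp a) (le_uSeminorm R hp b) (p.nonneg b) (uSeminorm_nonneg R a))

theorem uSeminorm_sq_le (a : A) :
    uSeminorm R a * uSeminorm R a ≤ uSeminorm R (star a * a) := by
  have h : uSeminorm R a ≤ √(uSeminorm R (star a * a)) :=
    uSeminorm_le R fun p hp => by
      refine Real.le_sqrt_of_sq_le ?_
      rw [pow_two, ← p.star_mul_self]
      exact le_uSeminorm R hp _
  have h2 := mul_self_le_mul_self (uSeminorm_nonneg R a) h
  rwa [Real.mul_self_sqrt (uSeminorm_nonneg R _)] at h2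

end

/-- The `*`-algebra `A` regarded as a seminormed algebra under the largest C*-seminorm
compatible with `R`. -/
def Pre {A : Type u} (_R : Set A) : Type u := A

instance (R : Set A) : Ring (Pre R) := inferInstanceAs (Ring A)
instance (R : Set A) : Algebra ℂ (Pre R) := inferInstanceAs (Algebra ℂ A)
instance (R : Set A) : StarRing (Pre R) := inferInstanceAs (StarRing A)
instance [StarModule ℂ A] (R : Set A) : StarModule ℂ (Pre R) := inferInstanceAs (StarModule ℂ A)

section

variable (R : Set A) [IsBoundedRel R]

/-- The largest compatible C*-seminorm as a group seminorm. -/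
def preSeminorm : AddGroupSeminorm (Pre R) where
  toFun := uSeminorm R
  map_zero' := uSeminorm_zero R
  add_le' := uSeminorm_add R
  neg' := uSeminorm_neg R

instance : SeminormedAddCommGroup (Pre R) := (preSeminorm R).toSeminormedAddCommGroup

instance : SeminormedRing (Pre R) where
  __ := (inferInstance : SeminormedAddCommGroup (Pre R))
  __ := (inferInstance : Ring (Pre R))
  norm_mul_le := uSeminorm_mul R

theorem norm_pre (a : Pre R) : ‖a‖ = uSeminorm (A := A) R a := rfl

instance : NormedAlgebra ℂ (Pre R) where
  norm_smul_le := uSeminorm_smul R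

instance : NormedStarGroup (Pre R) where
  norm_star_le a := (uSeminorm_star R a).le

/-- The universal C*-algebra of the `*`-algebra `A` subject to the relations `r = 0`, `r ∈ R`:
the Hausdorff completion of `A` in the largest C*-seminorm vanishing on `R`. -/
def UnivCStar : Type u := UniformSpace.Completion (Pre R)

namespace UnivCStar

open UniformSpace

instance : NormedRing (UnivCStar R) := inferInstanceAs (NormedRing (Completion (Pre R)))
instance : CompleteSpace (UnivCStar R) :=
  inferInstanceAs (CompleteSpace (Completion (Pre R)))
instance : Algebra ℂ (UnivCStar R) := inferInstanceAs (Algebra ℂ (Completion (Pre R)))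

variable {R}

/-- The canonical map with dense range. -/
def coe (a : A) : UnivCStar R := ((show Pre R from a) : Completion (Pre R))

theorem norm_coe (a : A) : ‖(coe a : UnivCStar R)‖ = uSeminorm R a :=
  Completion.norm_coe (E := Pre R) a

theorem coe_add (a b : A) : (coe (a + b) : UnivCStar R) = coe a + coe b :=
  Completion.coe_add (α := Pre R) a b

theorem coe_mul (a b : A) : (coe (a * b) : UnivCStar R) = coe a * coe b :=
  Completion.coe_mul (α := Pre R) a b

theorem coe_smul (c : ℂ) (a : A) : (coe (c • a) : UnivCStar R) = c • coe a :=
  Completion.coe_smul (X := Pre R) c a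

theorem coe_algebraMap (c : ℂ) : (coe (algebraMap ℂ A c) : UnivCStar R) = algebraMap ℂ _ c :=
  rfl

theorem denseRange_coe : DenseRange (coe : A → UnivCStar R) :=
  Completion.denseRange_coe (α := Pre R)

instance : NormedAlgebra ℂ (UnivCStar R) where
  norm_smul_le c x := NormedSpace.norm_smul_le (E := Completion (Pre R)) c x

instance : Star (UnivCStar R) := ⟨Completion.map (star : Pre R → Pre R)⟩

theorem star_coe (a : A) : star (coe a : UnivCStar R) = coe (star a) :=
  Completion.map_coe (α := Pre R) (β := Pre R) star_isometry.uniformContinuous a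

theorem continuous_star' : Continuous (star : UnivCStar R → UnivCStar R) :=
  Completion.continuous_map

instance : StarRing (UnivCStar R) where
  star_involutive x := by
    refine denseRange_coe.induction_on (p := fun x => star (star x) = x) x
      (isClosed_eq (continuous_star'.comp continuous_star') continuous_id) fun a => ?_
    rw [star_coe, star_coe, star_star]
  star_mul x y := by
    refine denseRange_coe.induction_on₂ (p := fun x y => star (x * y) = star y * star x)
      ?_ (fun a b => ?_) x y
    · exact isClosed_eq (continuous_star'.comp continuous_mul)
        ((continuous_star'.comp continuous_snd).mul (continuous_star'.comp continuous_fst))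
    · rw [← coe_mul, star_coe, star_coe, star_coe, star_mul, coe_mul]
  star_add x y := by
    refine denseRange_coe.induction_on₂ (p := fun x y => star (x + y) = star x + star y)
      ?_ (fun a b => ?_) x y
    · exact isClosed_eq (continuous_star'.comp continuous_add)
        ((continuous_star'.comp continuous_fst).add (continuous_star'.comp continuous_snd))
    · rw [← coe_add, star_coe, star_coe, star_coe, star_add, coe_add]

instance [StarModule ℂ A] : StarModule ℂ (UnivCStar R) where
  star_smul c x := by
    refine denseRange_coe.induction_on (p := fun x => star (c • x) = star c • star x) x
      (isClosed_eq (continuous_star'.comp (continuous_const_smul c))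
        ((continuous_const_smul (star c)).comp continuous_star')) fun a => ?_
    rw [← coe_smul, star_coe, star_coe, star_smul, coe_smul]

instance : CStarRing (UnivCStar R) where
  norm_mul_self_le x := by
    refine denseRange_coe.induction_on
      (p := fun x : UnivCStar R => ‖x‖ * ‖x‖ ≤ ‖star x * x‖) x
      (isClosed_le (continuous_norm.mul continuous_norm)
        (continuous_norm.comp (continuous_star'.mul continuous_id))) fun a => ?_
    rw [star_coe, ← coe_mul, norm_coe, norm_coe]
    exact uSeminorm_sq_le R a

instance [StarModule ℂ A] : CStarAlgebra (UnivCStar R) where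

variable (R) in
/-- The canonical `*`-homomorphism of `A` into the universal C*-algebra. -/
def of : A →⋆ₐ[ℂ] UnivCStar R where
  toFun := coe
  map_one' := rfl
  map_mul' := coe_mul
  map_zero' := rfl
  map_add' := coe_add
  commutes' := coe_algebraMap
  map_star' a := (star_coe a).symm

theorem of_eq_zero {r : A} (hr : r ∈ R) : of R r = 0 := by
  rw [← norm_eq_zero]
  refine (norm_coe r).trans (le_antisymm ?_ (uSeminorm_nonneg R r))
  exact uSeminorm_le R fun p hp => (hp r hr).le

/-- A homomorphism of `A`, regarded as a map on `Pre R`. -/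
def preHom {B : Type v} [CStarAlgebra B] (R : Set A) (φ : A →⋆ₐ[ℂ] B) : Pre R →+* B :=
  (φ : A →+* B)

theorem continuous_preHom {B : Type v} [CStarAlgebra B] (φ : A →⋆ₐ[ℂ] B)
    (hφ : ∀ r ∈ R, φ r = 0) : Continuous (preHom R φ) :=
  AddMonoidHomClass.continuous_of_bound (preHom R φ) 1 fun a => by
    rw [one_mul]
    exact le_uSeminorm R (p := CStarSeminorm.ofHom φ)
      (fun r hr => by rw [CStarSeminorm.ofHom_apply, hφ r hr, norm_zero]) a

/-- The universal property: a `*`-homomorphism of `A` into a C*-algebra that kills `R` extends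
to the universal C*-algebra. -/
def lift {B : Type v} [CStarAlgebra B] (φ : A →⋆ₐ[ℂ] B) (hφ : ∀ r ∈ R, φ r = 0) :
    UnivCStar R →⋆ₐ[ℂ] B :=
  have hc : Continuous (preHom R φ) := continuous_preHom φ hφ
  { (Completion.extensionHom (preHom R φ) hc : Completion (Pre R) →+* B) with
    commutes' := fun c =>
      (Completion.extensionHom_coe (preHom R φ) hc _).trans (AlgHomClass.commutes φ c)
    map_star' := fun x => by
      have hcoe : ∀ a : A, Completion.extensionHom (preHom R φ) hc (coe a : UnivCStar R)
          = φ a := fun a => Completion.extensionHom_coe (preHom R φ) hc a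
      have hcont : Continuous (Completion.extensionHom (preHom R φ) hc) :=
        Completion.continuous_extension
      refine denseRange_coe.induction_on (p := fun x : UnivCStar R =>
        Completion.extensionHom (preHom R φ) hc (star x : UnivCStar R)
          = star (Completion.extensionHom (preHom R φ) hc x)) x
        (isClosed_eq (hcont.comp continuous_star') hcont.star) fun a => ?_
      rw [star_coe, hcoe, hcoe, map_star] }

theorem lift_of {B : Type v} [CStarAlgebra B] (φ : A →⋆ₐ[ℂ] B) (hφ : ∀ r ∈ R, φ r = 0)
    (a : A) : lift φ hφ (of R a) = φ a :=
  Completion.extensionHom_coe (α := Pre R) (preHom R φ) (continuous_preHom φ hφ) a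

end UnivCStar

end

/-- Relations among the generators of a free `*`-algebra that force each generator to be
contractive are bounded. -/
theorem isBoundedRel_of_gen {X : Type u} (R : Set (FreeStar X))
    (h : ∀ p ∈ Compatible R, ∀ x, p (FreeStar.gen x) ≤ 1) : IsBoundedRel R where
  bounded a := by
    induction a using FreeStar.induction with
    | scalar c =>
      refine ⟨‖c‖, fun p _ => ?_⟩
      rw [Algebra.algebraMap_eq_smul_one, p.smul_eq]
      exact mul_le_of_le_one_right (norm_nonneg c) p.one_le_one
    | letter x =>
      refine ⟨1, fun p hp => ?_⟩
      rcases x with ⟨x, _ | _⟩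
      · exact h p hp x
      · have := h p hp x
        rwa [← p.star_eq, FreeStar.gen, FreeStar.star_letter] at this
    | mul a b ha hb =>
      obtain ⟨C, hC⟩ := ha
      obtain ⟨D, hD⟩ := hb
      exact ⟨C * D, fun p hp => (p.mul_le a b).trans
        (mul_le_mul (hC p hp) (hD p hp) (p.nonneg b) ((p.nonneg a).trans (hC p hp)))⟩
    | add a b ha hb =>
      obtain ⟨C, hC⟩ := ha
      obtain ⟨D, hD⟩ := hb
      exact ⟨C + D, fun p hp => (p.add_le a b).trans (add_le_add (hC p hp) (hD p hp))⟩

/-- Any relations in a C*-algebra are bounded. -/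
instance isBoundedRel_of_cstar {B : Type u} [CStarAlgebra B] (R : Set B) : IsBoundedRel R where
  bounded a := by
    obtain ⟨u, c, rfl, -⟩ := CStarAlgebra.exists_sum_four_unitary a
    refine ⟨∑ i, ‖c i‖, fun p _ => ?_⟩
    have hsub : ∀ s : Finset (Fin 4), p (∑ i ∈ s, c i • (u i : B)) ≤ ∑ i ∈ s, ‖c i‖ := by
      intro s
      induction s using Finset.cons_induction with
      | empty => simp
      | cons i s hi ih =>
        rw [Finset.sum_cons, Finset.sum_cons]
        refine (p.add_le _ _).trans (add_le_add ?_ ih)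
        rw [p.smul_eq]
        refine mul_le_of_le_one_right (norm_nonneg _) (p.le_one_of_isometry _ ?_)
        rw [Unitary.coe_star_mul_self, sub_self]
        exact map_zero p.toSeminorm
    exact hsub _

end Universal

/-! ### Isometric representations -/

section Semigroup

variable {G : Type u} [Group G]

/-- An isometric representation of the semigroup `P` in a unital `*`-ring `B`: isometries
`T p` with `T p * T q = T (p * q)`. -/
structure IsometricRep (P : Submonoid G) (B : Type v) [Ring B] [StarRing B] where
  toFun : P → B
  isometry : ∀ p, star (toFun p) * toFun p = 1
  map_mul : ∀ p q, toFun (p * q) = toFun p * toFun q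

instance (P : Submonoid G) (B : Type v) [Ring B] [StarRing B] :
    CoeFun (IsometricRep P B) (fun _ => P → B) := ⟨IsometricRep.toFun⟩

/-- The element `f p₁^* f q₁ ⋯ f pₙ^* f qₙ` for the list `(p₁, q₁), …, (pₙ, qₙ)`. -/
def word {P : Submonoid G} {B : Type v} [Ring B] [StarRing B] (f : P → B) (L : List (P × P)) : B :=
  (L.map fun x => star (f x.1) * f x.2).prod

/-- The element `p₁⁻¹ q₁ ⋯ pₙ⁻¹ qₙ` of `G` for the list `(p₁, q₁), …, (pₙ, qₙ)`. -/
def degree {P : Submonoid G} (L : List (P × P)) : G :=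
  (L.map fun x => (x.1 : G)⁻¹ * (x.2 : G)).prod

variable (P : Submonoid G)

/-- The relations `v_p^* v_p = 1` and `v_{pq} = v_p v_q`. -/
inductive IsoRel : FreeStar P → Prop
  | isometry (p : P) :
      IsoRel (star (FreeStar.gen p) * FreeStar.gen p - 1)
  | mul (p q : P) :
      IsoRel (FreeStar.gen (p * q) - FreeStar.gen p * FreeStar.gen q)

instance : IsBoundedRel {r | IsoRel P r} :=
  isBoundedRel_of_gen _ fun p hp x => p.le_one_of_isometry _ (hp _ (IsoRel.isometry x))

/-- The isometric semigroup C*-algebra: the universal C*-algebra generated by isometries `v_p`,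
`p ∈ P`, satisfying `v_p v_q = v_{pq}`. -/
abbrev CIso : Type u := UnivCStar {r | IsoRel P r}

namespace CIso

/-- The universal isometric representation of `P`. -/
def gen : IsometricRep P (CIso P) where
  toFun p := UnivCStar.of _ (FreeStar.gen p)
  isometry p := by
    have := UnivCStar.of_eq_zero (R := {r | IsoRel P r}) (IsoRel.isometry p)
    rwa [map_sub, map_mul, map_star, map_one, sub_eq_zero] at this
  map_mul p q := by
    have := UnivCStar.of_eq_zero (R := {r | IsoRel P r}) (IsoRel.mul p q)
    rwa [map_sub, _root_.map_mul, sub_eq_zero] at this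

variable {P}

/-- The `*`-homomorphism of the isometric semigroup C*-algebra induced by an isometric
representation of `P`. -/
def lift {B : Type v} [CStarAlgebra B] (T : IsometricRep P B) : CIso P →⋆ₐ[ℂ] B :=
  UnivCStar.lift (FreeStar.lift T) (by
    rintro _ (⟨p⟩ | ⟨p, q⟩)
    · rw [map_sub, map_mul, map_star, map_one, FreeStar.lift_gen, T.isometry, sub_self]
    · rw [map_sub, map_mul, FreeStar.lift_gen, FreeStar.lift_gen, FreeStar.lift_gen, T.map_mul,
        sub_self])

theorem lift_gen {B : Type v} [CStarAlgebra B] (T : IsometricRep P B) (p : P) :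
    lift T (gen P p) = T p :=
  (UnivCStar.lift_of _ _ _).trans (FreeStar.lift_gen _ _)

variable (P)

/-- The fixed point algebra of the canonical coaction `v_p ↦ v_p ⊗ u_p` of `G`: the closed
linear span of the words `v_{p₁}^* v_{q₁} ⋯ v_{pₙ}^* v_{qₙ}` with
`p₁⁻¹ q₁ ⋯ pₙ⁻¹ qₙ = e`. -/
def fixedPoints : Submodule ℂ (CIso P) :=
  (Submodule.span ℂ {a | ∃ L : List (P × P), degree L = 1 ∧ a = word (gen P) L}).topologicalClosure

end CIso

/-! ### Constructible ideals and the constructible semigroup C*-algebra -/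

variable {P} in
/-- The subset `p₁⁻¹ q₁ ⋯ pₙ⁻¹ qₙ P` of `P` for the list `(p₁, q₁), …, (pₙ, qₙ)`, where
`q X = {q x | x ∈ X}` and `p⁻¹ X = {y ∈ P | p y ∈ X}`. -/
def idealOf : List (P × P) → Set P
  | [] => Set.univ
  | (p, q) :: L => {y | p * y ∈ (fun x => q * x) '' idealOf L}

/-- The constructible right ideals of `P`. -/
def ConstructibleIdeals : Set (Set P) := {X | (∃ L : List (P × P), X = idealOf L) ∨ X = ∅}

/-- The constructible ideal `p₁⁻¹ q₁ ⋯ pₙ⁻¹ qₙ P`. -/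
def cIdeal (L : List (P × P)) : ConstructibleIdeals P := ⟨idealOf L, Or.inl ⟨L, rfl⟩⟩

/-- The empty constructible ideal. -/
def cEmpty : ConstructibleIdeals P := ⟨∅, Or.inr rfl⟩

/-- For the list `(p₁, q₁), …, (pₙ, qₙ)` the list `(qₙ, pₙ), …, (q₁, p₁)`. -/
def revList {P : Submonoid G} (L : List (P × P)) : List (P × P) := (L.map Prod.swap).reverse

/-- The generator `v_p` of the free `*`-algebra on the symbols `v_p` and `e_x`. -/
def freeV (p : P) : FreeStar (P ⊕ ConstructibleIdeals P) := FreeStar.gen (Sum.inl p)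

/-- The generator `e_x` of the free `*`-algebra on the symbols `v_p` and `e_x`. -/
def freeE (x : ConstructibleIdeals P) : FreeStar (P ⊕ ConstructibleIdeals P) :=
  FreeStar.gen (Sum.inr x)

/-- The relations of the constructible semigroup C*-algebra: the `v_p` are isometries, the `e_x`
are projections, `v_{pq} = v_p v_q`, `e_∅ = 0`, and
`v_{p₁}^* v_{q₁} ⋯ v_{pₙ}^* v_{qₙ} = e_x` with `x = qₙ⁻¹ pₙ ⋯ q₁⁻¹ p₁ P` whenever
`p₁⁻¹ q₁ ⋯ pₙ⁻¹ qₙ = e` in `G`. -/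
inductive ConRel : FreeStar (P ⊕ ConstructibleIdeals P) → Prop
  | isometry (p : P) : ConRel (star (freeV P p) * freeV P p - 1)
  | selfAdjoint (x : ConstructibleIdeals P) : ConRel (star (freeE P x) - freeE P x)
  | idempotent (x : ConstructibleIdeals P) : ConRel (freeE P x * freeE P x - freeE P x)
  | mul (p q : P) : ConRel (freeV P (p * q) - freeV P p * freeV P q)
  | empty : ConRel (freeE P (cEmpty P))
  | graded (L : List (P × P)) (hL : degree L = 1) :
      ConRel (word (freeV P) L - freeE P (cIdeal P (revList L)))

instance : IsBoundedRel {r | ConRel P r} :=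
  isBoundedRel_of_gen _ fun p hp x => by
    rcases x with x | x
    · exact p.le_one_of_isometry _ (hp _ (ConRel.isometry x))
    · exact p.le_one_of_projection _ (hp _ (ConRel.selfAdjoint x)) (hp _ (ConRel.idempotent x))

/-- The constructible semigroup C*-algebra `C*_s(P)`. -/
abbrev CCon : Type u := UnivCStar {r | ConRel P r}

/-- The canonical isometric representation of `P` in the constructible semigroup C*-algebra. -/
def CCon.gen : IsometricRep P (CCon P) where
  toFun p := UnivCStar.of _ (freeV P p)
  isometry p := by
    have := UnivCStar.of_eq_zero (R := {r | ConRel P r}) (ConRel.isometry p)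
    rwa [map_sub, map_mul, map_star, map_one, sub_eq_zero] at this
  map_mul p q := by
    have := UnivCStar.of_eq_zero (R := {r | ConRel P r}) (ConRel.mul p q)
    rwa [map_sub, _root_.map_mul, sub_eq_zero] at this

/-- The canonical `*`-homomorphism from the isometric to the constructible semigroup
C*-algebra. -/
def isoToCon : CIso P →⋆ₐ[ℂ] CCon P := CIso.lift (CCon.gen P)

/-! ### Strong covariance -/

/-- The operator `ℓ²(ι) → ℓ²(κ)`, `δ_i ↦ δ_{f i}`, of an injective map `f`. -/
def ell2Map {ι : Type u} {κ : Type v} (f : ι → κ) (hf : Function.Injective f) :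
    lp (fun _ : ι => ℂ) 2 →ₗᵢ[ℂ] lp (fun _ : κ => ℂ) 2 :=
  (((default : HilbertBasis κ ℂ (lp (fun _ : κ => ℂ) 2)).orthonormal.comp
    f hf).orthogonalFamily).linearIsometry

/-- The standard orthonormal basis of `ℓ²(ι)`. -/
def stdBasis (ι : Type u) : HilbertBasis ι ℂ (lp (fun _ : ι => ℂ) 2) := default

theorem ell2Map_basis {ι : Type u} {κ : Type v} (f : ι → κ) (hf : Function.Injective f) (i : ι) :
    ell2Map f hf (stdBasis ι i) = stdBasis κ (f i) := by
  classical
  have h : stdBasis ι i = lp.single 2 i (1 : ℂ) := (stdBasis ι).repr_symm_single i |>.symm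
  rw [h, ell2Map, OrthogonalFamily.linearIsometry_apply_single]
  simp [stdBasis]

theorem ell2Map_comp {ι κ μ : Type u} (f : ι → κ) (hf : Function.Injective f)
    (g : κ → μ) (hg : Function.Injective g) :
    (ell2Map (g ∘ f) (hg.comp hf)).toContinuousLinearMap
      = (ell2Map g hg).toContinuousLinearMap ∘L (ell2Map f hf).toContinuousLinearMap := by
  refine ContinuousLinearMap.ext_on (s := Set.range (stdBasis ι)) ?_ ?_
  · rw [Submodule.dense_iff_topologicalClosure_eq_top]
    exact (stdBasis ι).dense_span
  · rintro _ ⟨i, rfl⟩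
    change ell2Map (g ∘ f) (hg.comp hf) (stdBasis ι i) = ell2Map g hg (ell2Map f hf (stdBasis ι i))
    rw [ell2Map_basis, ell2Map_basis, ell2Map_basis, Function.comp]

/-- `K_F = ⋂_{g ∈ F} gP`. -/
def K (F : Set G) : Set G := ⋂ g ∈ F, {h | ∃ p ∈ P, h = g * p}

open Classical in
/-- The ideal `I_{r⁻¹ K_{r,g}}` of `ℂ`: it is `0` if `K_{r,g} ≠ ∅` and `r ∉ K_{r,g}`, and `ℂ`
otherwise. -/
def covI (r g : G) : Ideal ℂ :=
  if (K P {r, g}).Nonempty ∧ r ∉ K P {r, g} then ⊥ else ⊤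

/-- Whether `I_{r⁻¹(r ∨ F)} ≠ 0`, where `I_{r⁻¹(r ∨ F)} = ⋂_{g ∈ F} I_{r⁻¹ K_{r,g}}`. -/
def InX (F : Finset G) (r : G) : Prop := (⨅ g ∈ F, covI P r g) ≠ ⊥

/-- The translate `gF`. -/
def translate (g : G) (F : Finset G) : Finset G := F.map (Equiv.mulLeft g).toEmbedding

/-- The index set of the standard basis of `X_F⁺`: the pairs `(g, r)` with `r ∈ P` and
`δ_r ∈ X_{gF}`. -/
def XIndex (F : Finset G) : Type u := {x : G × P // InX P (translate x.1 F) x.2}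

/-- The Hilbert space `X_F⁺ = ⨁_{g ∈ G} X_{gF}`, where `X_F` is the closed span of the `δ_r`
in `ℓ²(P)` with `I_{r⁻¹(r ∨ F)} ≠ 0`. -/
abbrev XPlus (F : Finset G) : Type u := lp (fun _ : XIndex P F => ℂ) 2

theorem mem_K_mul (a h r g : G) : h ∈ K P {a * r, a * g} ↔ a⁻¹ * h ∈ K P {r, g} := by
  simp [K, inv_mul_eq_iff_eq_mul, mul_assoc]

theorem covI_mul (a r g : G) : covI P (a * r) (a * g) = covI P r g := by
  have h1 : (K P {a * r, a * g}).Nonempty ↔ (K P {r, g}).Nonempty :=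
    ⟨fun ⟨h, hh⟩ => ⟨_, (mem_K_mul P a h r g).1 hh⟩,
      fun ⟨h, hh⟩ => ⟨a * h, (mem_K_mul P a _ r g).2 (by simpa using hh)⟩⟩
  have h2 : a * r ∈ K P {a * r, a * g} ↔ r ∈ K P {r, g} := by
    rw [mem_K_mul, inv_mul_cancel_left]
  unfold covI
  rw [h1, h2]

theorem inX_mul (F : Finset G) (a g r : G) (h : InX P (translate g F) r) :
    InX P (translate (a * g) F) (a * r) := by
  have key : ∀ a r : G, (⨅ y ∈ translate a F, covI P r y) = F.inf fun y => covI P r (a * y) := by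
    intro a r
    rw [← Finset.inf_eq_iInf, translate, Finset.inf_map]
    rfl
  unfold InX at *
  rw [key] at *
  simpa only [mul_assoc, covI_mul] using h

variable {P} in
/-- The map `(g, r) ↦ (pg, pr)` on basis indices. -/
def shift (F : Finset G) (p : P) (x : XIndex P F) : XIndex P F :=
  ⟨(p * x.1.1, p * x.1.2), inX_mul P F p x.1.1 x.1.2 x.2⟩

theorem shift_injective (F : Finset G) (p : P) : Function.Injective (shift F p) := by
  intro x y h
  have h' := congrArg Subtype.val h
  simp only [shift, Prod.mk.injEq, mul_left_cancel_iff] at h'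
  exact Subtype.ext (Prod.ext h'.1 h'.2)

theorem shift_mul (F : Finset G) (p q : P) : shift F (p * q) = shift F p ∘ shift F q := by
  funext x
  exact Subtype.ext (Prod.ext (mul_assoc _ _ _) (mul_assoc _ _ _))

/-- The isometry `V_{F,p}` of `X_F⁺`, `X_{gF} ∋ δ_r ↦ δ_{pr} ∈ X_{pgF}`. -/
def VOp (F : Finset G) (p : P) : XPlus P F →L[ℂ] XPlus P F :=
  (ell2Map (shift F p) (shift_injective P F p)).toContinuousLinearMap

/-- The isometric representation `p ↦ V_{F,p}`. -/
def VRep (F : Finset G) : IsometricRep P (XPlus P F →L[ℂ] XPlus P F) where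
  toFun := VOp P F
  isometry p := (ContinuousLinearMap.norm_map_iff_adjoint_comp_self _).1 fun x =>
    (ell2Map (shift F p) (shift_injective P F p)).norm_map x
  map_mul p q := by
    unfold VOp
    rw [ContinuousLinearMap.mul_def, ← ell2Map_comp]
    congr 2
    exact shift_mul P F p q

/-- The representation `Φ_F` of the isometric semigroup C*-algebra on `X_F⁺`. -/
def Phi (F : Finset G) : CIso P →⋆ₐ[ℂ] (XPlus P F →L[ℂ] XPlus P F) := CIso.lift (VRep P F)

/-- The inclusion of `X_{gF}` into `X_F⁺`. -/
def incl (F : Finset G) (g : G) :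
    lp (fun _ : {r : P // InX P (translate g F) r} => ℂ) 2 →L[ℂ] XPlus P F :=
  (ell2Map (fun r => (⟨(g, r.1), r.2⟩ : XIndex P F)) fun r s h => by
    have h' := congrArg Subtype.val h
    exact Subtype.ext (Prod.ext_iff.1 h').2).toContinuousLinearMap

/-- The projection `Q_{g,F}` of `X_F⁺` onto `X_{gF}`. -/
def QProj (F : Finset G) (g : G) : XPlus P F →L[ℂ] XPlus P F :=
  incl P F g ∘L (incl P F g).adjoint

/-- `‖f‖_F = ‖Q_{e,F} Φ_F(f) Q_{e,F}‖`. -/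
def normF (F : Finset G) (f : CIso P) : ℝ := ‖QProj P F 1 * Phi P F f * QProj P F 1‖

/-- The ideal `I_e` of the fixed point algebra: the `f` with `lim_F ‖f‖_F = 0`, the limit being
along the finite subsets `F` of `G` directed by inclusion. -/
def covIdeal : Set (CIso P) :=
  {f | f ∈ CIso.fixedPoints P ∧ Filter.Tendsto (fun F => normF P F f) Filter.atTop (𝓝 0)}

/-- The strong covariance algebra `C*_sc(P)`: the universal C*-algebra for the representations
of the isometric semigroup C*-algebra that vanish on `I_e`. -/
abbrev CSc : Type u := UnivCStar (covIdeal P)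

/-- The canonical `*`-homomorphism from the isometric semigroup C*-algebra to the strong
covariance algebra. -/
def isoToSc : CIso P →⋆ₐ[ℂ] CSc P := UnivCStar.of (covIdeal P)

variable {P} in
/-- An isometric representation is strongly covariant if it vanishes on `I_e`. -/
def IsometricRep.IsStronglyCovariant {B : Type v} [CStarAlgebra B] (T : IsometricRep P B) : Prop :=
  ∀ f ∈ covIdeal P, CIso.lift T f = 0

variable {P} in
/-- An isometric representation is constructible if it induces a representation of
`C*_s(P)`. -/
def IsometricRep.IsConstructible {B : Type v} [CStarAlgebra B] (T : IsometricRep P B) : Prop :=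
  ∃ ψ : CCon P →⋆ₐ[ℂ] B, ∀ p, ψ (CCon.gen P p) = T p

end Semigroup

end SemigroupCStar
end

/-! A list `L` acts on `P` as the partial bijection `y ↦ (degree L)⁻¹ y` with domain `idealOf L`;
reversing `L` inverts it, and concatenation composes. On `X_F⁺` the word of `L` therefore sends a
basis vector to a basis vector when its `P`-coordinate lies in `idealOf (revList L)`, and kills it
otherwise (`word_VRep_basis`). In degree one it is the diagonal projection onto the coordinates in
that ideal, so under every `Phi P F` it depends only on the ideal. Differences of degree-one words
with equal ideals, and degree-one words with empty ideal, hence lie in `covIdeal P`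
(`word_sub_word_mem_covIdeal`, `word_mem_covIdeal`).

A strongly covariant `T` thus gives a well-defined element `idealProj T x` for each ideal `x`, and
reversal and concatenation of lists show that it is a projection. These elements satisfy all
relations of `C*_s(P)`, so `T` is constructible. The map `π` arises by applying this to the
universal strongly covariant representation.

Surjectivity onto `C*_s(P)` has two ingredients: each `e_x` is already a word in the isometries
(`CCon.of_freeE_cIdeal`), and a `*`-homomorphism of C*-algebras with dense range is onto
(`surjective_of_denseRange`). Uniqueness of `π` follows from this surjectivity. -/

noncomputable section

namespace SemigroupCStar

/-! ### Ranges of `*`-homomorphisms of C*-algebras are closed. -/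

section ClosedRange

variable {A : Type u} {B : Type v} [CStarAlgebra A] [CStarAlgebra B]

theorem continuous_starAlgHom (φ : A →⋆ₐ[ℂ] B) : Continuous φ :=
  AddMonoidHomClass.continuous_of_bound φ 1 fun a => by
    rw [one_mul]
    exact NonUnitalStarAlgHom.norm_apply_le φ a

theorem map_real_smul_starAlgHom (φ : A →⋆ₐ[ℂ] B) (r : ℝ) (a : A) : φ (r • a) = r • φ a := by
  rw [← Complex.coe_smul, map_smul, Complex.coe_smul]

theorem map_realPart (φ : A →⋆ₐ[ℂ] B) (a : A) : φ (realPart a : A) = realPart (φ a) := by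
  rw [realPart_apply_coe, realPart_apply_coe, map_real_smul_starAlgHom, map_add, map_star]

theorem map_imaginaryPart (φ : A →⋆ₐ[ℂ] B) (a : A) :
    φ (imaginaryPart a : A) = imaginaryPart (φ a) := by
  rw [imaginaryPart_apply_coe, imaginaryPart_apply_coe, map_smul, map_real_smul_starAlgHom,
    map_sub, map_star]

/-- A self-adjoint element of the range of a `*`-homomorphism of C*-algebras lifts to an element
of no larger norm. -/
theorem exists_lift_norm_le_of_isSelfAdjoint (φ : A →⋆ₐ[ℂ] B) (a : A) (h : IsSelfAdjoint (φ a)) :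
    ∃ c, φ c = φ a ∧ ‖c‖ ≤ ‖φ a‖ := by
  set M := ‖φ a‖
  have hM : 0 ≤ M := norm_nonneg _
  have hφ : Continuous φ := continuous_starAlgHom φ
  -- Passing to the real part does not change the image, since `φ a` is self-adjoint, and makes
  -- functional calculus available in `A`.
  set s : A := (realPart a : A)
  have hs : IsSelfAdjoint s := (realPart a).2
  have hφs : φ s = φ a := (map_realPart φ a).trans h.coe_realPart
  have hcont : Continuous (fun t : ℝ => max (-M) (min t M)) := by fun_prop
  -- Truncating at `±M` bounds the norm by `M`. It does not alter the image: `φ` commutes with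
  -- functional calculus, and the spectrum of `φ a` already lies in `[-M, M]`.
  refine ⟨cfc (fun t : ℝ => max (-M) (min t M)) s, ?_, norm_cfc_le hM fun t _ => ?_⟩
  · rw [StarAlgHomClass.map_cfc φ _ s hcont.continuousOn hφ hs (hφs ▸ h), hφs]
    conv_rhs => rw [← cfc_id ℝ (φ a) h]
    refine cfc_congr fun t ht => ?_
    -- In the zero algebra the spectrum is empty, so `ht` itself is the contradiction.
    have : Nontrivial B := by
      by_contra hB
      have := not_nontrivial_iff_subsingleton.1 hB
      rw [spectrum.of_subsingleton] at ht
      exact ht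
    have := abs_le.1 (spectrum.norm_le_norm_of_mem ht)
    simp only [id]
    rw [min_eq_left this.2, max_eq_right this.1]
  · rw [Real.norm_eq_abs, abs_le]
    exact ⟨le_max_left _ _, max_le (by linarith) (min_le_right _ _)⟩

/-- An element of the range of a `*`-homomorphism of C*-algebras lifts to an element of at most
twice the norm. -/
theorem exists_lift_norm_le (φ : A →⋆ₐ[ℂ] B) (a : A) : ∃ c, φ c = φ a ∧ ‖c‖ ≤ 2 * ‖φ a‖ := by
  have hre := map_realPart φ a
  have him := map_imaginaryPart φ a
  -- Real and imaginary parts are lifted separately, each at cost at most `‖φ a‖`; hence the factor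
  -- 2.
  obtain ⟨c, hc, hc'⟩ := exists_lift_norm_le_of_isSelfAdjoint φ (realPart a : A)
    (hre ▸ (realPart (φ a)).2)
  obtain ⟨d, hd, hd'⟩ := exists_lift_norm_le_of_isSelfAdjoint φ (imaginaryPart a : A)
    (him ▸ (imaginaryPart (φ a)).2)
  refine ⟨c + Complex.I • d, ?_, ?_⟩
  · rw [map_add, map_smul, hc, hd, hre, him, realPart_add_I_smul_imaginaryPart]
  · rw [hre] at hc'
    rw [him] at hd'
    have h1 : ‖c‖ ≤ ‖φ a‖ := hc'.trans (realPart.norm_le (φ a))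
    have h2 : ‖d‖ ≤ ‖φ a‖ := hd'.trans (imaginaryPart.norm_le (φ a))
    calc ‖c + Complex.I • d‖ ≤ ‖c‖ + ‖Complex.I • d‖ := norm_add_le _ _
      _ = ‖c‖ + ‖d‖ := by rw [norm_smul, Complex.norm_I, one_mul]
      _ ≤ 2 * ‖φ a‖ := by linarith

/-- A `*`-homomorphism of C*-algebras with dense range is surjective. -/
theorem surjective_of_denseRange (φ : A →⋆ₐ[ℂ] B) (h : DenseRange φ) :
    Function.Surjective φ := by
  let f : NormedAddGroupHom A B :=
    { toFun := φ
      map_add' := map_add φ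
      bound' := ⟨1, fun a => by rw [one_mul]; exact NonUnitalStarAlgHom.norm_apply_le φ a⟩ }
  -- Lifting with a uniform bound on the range extends to its closure, by summing successive
  -- corrections in the complete space `A`.
  have hf : f.SurjectiveOnWith f.range 2 := by
    rintro _ ⟨a, rfl⟩
    exact exists_lift_norm_le φ a
  intro b
  obtain ⟨a, ha, -⟩ := controlled_closure_of_complete two_pos one_pos hf b (h b)
  exact ⟨a, ha⟩

end ClosedRange

/-! ### Homomorphisms out of universal algebras are determined on generators. -/

section Universal

variable {A : Type u} [Ring A] [StarRing A] [Algebra ℂ A] [StarModule ℂ A]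
  {R : Set A} [IsBoundedRel R] {B : Type v} [CStarAlgebra B]

theorem UnivCStar.hom_ext {φ ψ : UnivCStar R →⋆ₐ[ℂ] B}
    (h : ∀ a, φ (UnivCStar.of R a) = ψ (UnivCStar.of R a)) : φ = ψ := by
  refine DFunLike.coe_injective (UnivCStar.denseRange_coe.equalizer (continuous_starAlgHom φ)
    (continuous_starAlgHom ψ) (funext h))

theorem UnivCStar.surjective_of_range (φ : B →⋆ₐ[ℂ] UnivCStar R)
    (h : ∀ a, UnivCStar.of R a ∈ φ.range) : Function.Surjective φ :=
  surjective_of_denseRange φ (UnivCStar.denseRange_coe.mono (by rintro _ ⟨a, rfl⟩; exact h a))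

theorem FreeStar.mem_of_gen {X : Type u} {C : Type v} [Ring C] [StarRing C] [Algebra ℂ C]
    [StarModule ℂ C] (φ : FreeStar X →⋆ₐ[ℂ] C) (S : StarSubalgebra ℂ C)
    (h : ∀ x, φ (FreeStar.gen x) ∈ S) (a : FreeStar X) : φ a ∈ S := by
  induction a using FreeStar.induction with
  | scalar c => rw [AlgHomClass.commutes]; exact S.algebraMap_mem c
  | letter x =>
    rcases x with ⟨x, _ | _⟩
    · exact h x
    · have : FreeStar.letter (x, true) = star (FreeStar.gen x) :=
        (FreeStar.star_letter (x, false)).symm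
      rw [this, map_star]
      exact star_mem (h x)
  | mul a b ha hb => rw [map_mul]; exact mul_mem ha hb
  | add a b ha hb => rw [map_add]; exact add_mem ha hb

theorem FreeStar.hom_ext {X : Type u} {C : Type v} [Ring C] [StarRing C] [Algebra ℂ C]
    [StarModule ℂ C] {φ ψ : FreeStar X →⋆ₐ[ℂ] C}
    (h : ∀ x, φ (FreeStar.gen x) = ψ (FreeStar.gen x)) : φ = ψ :=
  -- The equalizer is a `*`-subalgebra containing the generators, hence everything.
  StarAlgHom.ext fun a => FreeStar.mem_of_gen (StarAlgHom.id ℂ _) (StarAlgHom.equalizer φ ψ) h a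

end Universal

/-! ### Combinatorics of lists, degrees, ideals and words. -/

section Semigroup

variable {G : Type u} [Group G] {P : Submonoid G}

theorem degree_cons (x : P × P) (L : List (P × P)) :
    degree (x :: L) = (x.1 : G)⁻¹ * x.2 * degree L := by
  simp [degree]

theorem degree_append (L M : List (P × P)) : degree (L ++ M) = degree L * degree M := by
  simp [degree]

theorem revList_cons (x : P × P) (L : List (P × P)) :
    revList (x :: L) = revList L ++ [(x.2, x.1)] := by
  simp [revList, Prod.swap]

theorem revList_append (L M : List (P × P)) :
    revList (L ++ M) = revList M ++ revList L := by
  simp [revList]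

theorem revList_revList (L : List (P × P)) : revList (revList L) = L := by
  simp [revList, List.map_reverse]

theorem degree_revList (L : List (P × P)) : degree (revList L) = (degree L)⁻¹ := by
  induction L with
  | nil => simp [revList, degree]
  | cons x L ih => rw [revList_cons, degree_append, ih, degree_cons]; simp [degree]

theorem mem_idealOf_cons {p q : P} {L : List (P × P)} {y : P} :
    y ∈ idealOf ((p, q) :: L) ↔ ∃ x ∈ idealOf L, q * x = p * y := Iff.rfl

/-- Domain of a composite of partial bijections: `y` must survive `L`, and its image `s = (degree
L)⁻¹ y` must survive `M`. -/
theorem mem_idealOf_append {L M : List (P × P)} {y : P} :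
    y ∈ idealOf (L ++ M) ↔ y ∈ idealOf L ∧ ∃ s ∈ idealOf M, (y : G) = degree L * s := by
  induction L generalizing y with
  | nil =>
    have : degree ([] : List (P × P)) = 1 := rfl
    simp only [List.nil_append, this, one_mul, idealOf, Set.mem_univ, true_and]
    exact ⟨fun h => ⟨y, h, rfl⟩, fun ⟨s, hs, h⟩ => Subtype.ext h ▸ hs⟩
  | cons x L ih =>
    obtain ⟨p, q⟩ := x
    simp only [List.cons_append, mem_idealOf_cons, ih, degree_cons]
    constructor
    · rintro ⟨x, ⟨hx, s, hs, e⟩, h⟩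
      have h' : (q : G) * x = p * y := congrArg Subtype.val h
      exact ⟨⟨x, hx, h⟩, s, hs, by rw [mul_assoc, mul_assoc, ← e, h', inv_mul_cancel_left]⟩
    · rintro ⟨⟨x, hx, h⟩, s, hs, e⟩
      have h' : (q : G) * x = p * y := congrArg Subtype.val h
      refine ⟨x, ⟨hx, s, hs, ?_⟩, h⟩
      rw [e] at h'
      simpa [mul_assoc] using h'

/-- Reversing a list inverts its partial bijection, so the domain of one is the range of the other.
-/
theorem mem_idealOf_iff_revList {L : List (P × P)} {y : P} :
    y ∈ idealOf L ↔ ∃ s ∈ idealOf (revList L), (y : G) = degree L * s := by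
  induction L generalizing y with
  | nil =>
    refine ⟨fun _ => ⟨y, trivial, by simp [degree]⟩, fun _ => trivial⟩
  | cons x L ih =>
    obtain ⟨p, q⟩ := x
    simp only [revList_cons, mem_idealOf_append, mem_idealOf_cons, ih, degree_cons,
      degree_revList]
    constructor
    · rintro ⟨x, ⟨s, hs, e⟩, h⟩
      have h' : (q : G) * x = p * y := congrArg Subtype.val h
      refine ⟨s, ⟨hs, x, ⟨y, trivial, h.symm⟩, ?_⟩, ?_⟩
      · rw [e, inv_mul_cancel_left]
      · rw [mul_assoc, mul_assoc, ← e, h', inv_mul_cancel_left]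
    · rintro ⟨s, ⟨hs, x, -, e⟩, h⟩
      have e' : (x : G) = degree L * s := by rw [e, mul_inv_cancel_left]
      refine ⟨x, ⟨s, hs, e'⟩, Subtype.ext ?_⟩
      change (q : G) * x = p * y
      rw [h, e']
      simp [mul_assoc]

/-- A partial bijection followed by its inverse is the identity on its domain. Consequently every
`idealOf L` is the ideal of a degree-one list. -/
theorem idealOf_append_revList (L : List (P × P)) : idealOf (L ++ revList L) = idealOf L := by
  ext y
  rw [mem_idealOf_append, and_iff_left_iff_imp]
  exact mem_idealOf_iff_revList.1

/-- In degree one the partial bijection is an identity map, so its domain and range coincide. -/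
theorem idealOf_revList {L : List (P × P)} (hL : degree L = 1) :
    idealOf (revList L) = idealOf L := by
  ext y
  rw [mem_idealOf_iff_revList (L := L), hL]
  simp only [one_mul]
  exact ⟨fun h => ⟨y, h, rfl⟩, fun ⟨s, hs, h⟩ => Subtype.ext h ▸ hs⟩

theorem idealOf_append {L M : List (P × P)} (hL : degree L = 1) :
    idealOf (L ++ M) = idealOf L ∩ idealOf M := by
  ext y
  rw [mem_idealOf_append, hL, Set.mem_inter_iff]
  refine and_congr_right fun _ => ?_
  simp only [one_mul]
  exact ⟨fun ⟨s, hs, h⟩ => Subtype.ext h ▸ hs, fun h => ⟨y, h, rfl⟩⟩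

section Word

variable {B : Type v} [Ring B] [StarRing B]

theorem word_cons (f : P → B) (x : P × P) (L : List (P × P)) :
    word f (x :: L) = star (f x.1) * f x.2 * word f L := by
  simp [word]

theorem word_append (f : P → B) (L M : List (P × P)) :
    word f (L ++ M) = word f L * word f M := by
  simp [word]

theorem star_word (f : P → B) (L : List (P × P)) : star (word f L) = word f (revList L) := by
  induction L with
  | nil => simp [word, revList]
  | cons x L ih => rw [word_cons, star_mul, ih, revList_cons, word_append]; simp [word]

theorem map_word {C : Type w} [Ring C] [StarRing C] [Algebra ℂ B] [Algebra ℂ C]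
    (φ : B →⋆ₐ[ℂ] C) (f : P → B) (L : List (P × P)) :
    φ (word f L) = word (fun p => φ (f p)) L := by
  induction L with
  | nil => simp [word]
  | cons x L ih => rw [word_cons, word_cons, map_mul, map_mul, map_star, ih]

end Word

/-! ### Words of degree one on the Hilbert spaces `X_F⁺` -/

theorem VOp_basis (F : Finset G) (p : P) (x : XIndex P F) :
    VOp P F p (stdBasis _ x) = stdBasis _ (shift F p x) :=
  ell2Map_basis _ (shift_injective P F p) x

theorem star_VOp_basis_shift (F : Finset G) (p : P) (x : XIndex P F) :
    star (VOp P F p) (stdBasis _ (shift F p x)) = stdBasis _ x := by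
  rw [← VOp_basis]
  exact congrArg (fun S : XPlus P F →L[ℂ] XPlus P F => S (stdBasis _ x)) ((VRep P F).isometry p)

/-- The vector is orthogonal to every basis vector of the range of the isometry, hence is killed by
the adjoint. -/
theorem star_VOp_basis_of_notMem (F : Finset G) (p : P) (x : XIndex P F)
    (hx : ∀ y, shift F p y ≠ x) : star (VOp P F p) (stdBasis _ x) = 0 := by
  apply (stdBasis (XIndex P F)).repr.injective
  ext y
  rw [HilbertBasis.repr_apply_apply, ContinuousLinearMap.star_eq_adjoint,
    ContinuousLinearMap.adjoint_inner_right, VOp_basis,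
    (stdBasis (XIndex P F)).orthonormal.2 (hx y)]
  simp

/-- The condition `InX` is invariant under translation by all of `G`, in particular by `p⁻¹`.
Undoing a shift is therefore obstructed only by whether the second coordinate lies in `pP`. -/
theorem exists_shift_eq_iff (F : Finset G) (p : P) (x : XIndex P F) :
    (∃ y, shift F p y = x) ↔ ∃ s : P, p * s = x.1.2 := by
  constructor
  · rintro ⟨y, rfl⟩
    exact ⟨y.1.2, rfl⟩
  · rintro ⟨s, hs⟩
    obtain ⟨⟨g, r⟩, hx⟩ := x
    have h := inX_mul P F (p : G)⁻¹ g r hx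
    have hs' : (p : G)⁻¹ * r = s := by rw [← (show p * s = r from hs)]; simp
    rw [hs'] at h
    refine ⟨⟨((p : G)⁻¹ * g, s), h⟩, Subtype.ext (Prod.ext ?_ hs)⟩
    exact mul_inv_cancel_left _ _

/-- The word of a list `L` maps `δ_r ∈ X_{gF}` to `δ_{dr} ∈ X_{dgF}`, with `d` the degree of `L`,
if `r` lies in the ideal of the reversed list, and to `0` otherwise. -/
theorem word_VRep_basis (F : Finset G) (L : List (P × P)) (x : XIndex P F) :
    (x.1.2 ∈ idealOf (revList L) → ∃ y : XIndex P F, y.1.1 = degree L * x.1.1 ∧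
        (y.1.2 : G) = degree L * x.1.2 ∧ word (VRep P F) L (stdBasis _ x) = stdBasis _ y) ∧
      (x.1.2 ∉ idealOf (revList L) → word (VRep P F) L (stdBasis _ x) = 0) := by
  induction L with
  | nil =>
    refine ⟨fun _ => ⟨x, by simp [degree], by simp [degree], by simp [word]⟩, fun h => ?_⟩
    exact absurd trivial h
  | cons a L ih =>
    obtain ⟨p, q⟩ := a
    have hw : word (VRep P F) ((p, q) :: L) (stdBasis _ x)
        = star (VOp P F p) (VOp P F q (word (VRep P F) L (stdBasis _ x))) := by
      rw [word_cons]; rfl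
    rw [hw]
    -- Operators act from the right end of the word, which is why the reversed list governs the
    -- domain: first `r` must survive `L`, then its image `s` must satisfy `qs ∈ pP`.
    simp only [revList_cons, mem_idealOf_append, mem_idealOf_cons, degree_revList, degree_cons]
    by_cases hx : x.1.2 ∈ idealOf (revList L)
    · obtain ⟨y, hy1, hy2, hy⟩ := ih.1 hx
      rw [hy, VOp_basis]
      constructor
      · rintro ⟨-, s, ⟨t, -, ht⟩, hs⟩
        have hsy : s = y.1.2 := Subtype.ext (by rw [hy2, hs, mul_inv_cancel_left])
        obtain ⟨z, hz⟩ := (exists_shift_eq_iff F p (shift F q y)).2 ⟨t, by rw [ht, hsy]; rfl⟩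
        refine ⟨z, ?_, ?_, ?_⟩
        · have : (p : G) * z.1.1 = q * y.1.1 := congrArg (fun w => w.1.1) hz
          rw [mul_assoc, mul_assoc, ← hy1, ← this, inv_mul_cancel_left]
        · have : (p : G) * z.1.2 = q * y.1.2 := congrArg (fun w => (w.1.2 : G)) hz
          rw [mul_assoc, mul_assoc, ← hy2, ← this, inv_mul_cancel_left]
        · rw [← hz, star_VOp_basis_shift]
      · intro h
        refine star_VOp_basis_of_notMem F p _ fun z hz => h ⟨hx, y.1.2, ⟨z.1.2, trivial, ?_⟩, ?_⟩
        · exact congrArg (fun w => w.1.2) hz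
        · rw [hy2, inv_mul_cancel_left]
    · exact ⟨fun h => absurd h.1 hx, fun _ => by rw [ih.2 hx, map_zero, map_zero]⟩

theorem word_VRep_basis_of_degree_eq_one (F : Finset G) {L : List (P × P)} (hL : degree L = 1)
    (x : XIndex P F) [Decidable (x.1.2 ∈ idealOf (revList L))] :
    word (VRep P F) L (stdBasis _ x)
      = if x.1.2 ∈ idealOf (revList L) then stdBasis _ x else 0 := by
  split_ifs with h
  · obtain ⟨y, h1, h2, hy⟩ := (word_VRep_basis F L x).1 h
    rw [hL, one_mul] at h1 h2
    rw [hy, show y = x from Subtype.ext (Prod.ext h1 (Subtype.ext h2))]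
  · exact (word_VRep_basis F L x).2 h

theorem Phi_word (F : Finset G) (L : List (P × P)) :
    Phi P F (word (CIso.gen P) L) = word (VRep P F) L := by
  rw [map_word]
  congr 1
  exact funext fun p => CIso.lift_gen _ p

/-- Both operators are diagonal projections with the same support. -/
theorem word_VRep_eq_of_idealOf_eq (F : Finset G) {L M : List (P × P)} (hL : degree L = 1)
    (hM : degree M = 1) (h : idealOf (revList L) = idealOf (revList M)) :
    word (VRep P F) L = word (VRep P F) M := by
  classical
  refine ContinuousLinearMap.ext_on (s := Set.range (stdBasis (XIndex P F))) ?_ ?_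
  · rw [Submodule.dense_iff_topologicalClosure_eq_top]
    exact (stdBasis _).dense_span
  · rintro _ ⟨x, rfl⟩
    rw [word_VRep_basis_of_degree_eq_one F hL, word_VRep_basis_of_degree_eq_one F hM]
    simp only [h]

theorem word_VRep_eq_zero_of_idealOf_eq_empty (F : Finset G) {L : List (P × P)}
    (hL : degree L = 1) (h : idealOf (revList L) = ∅) : word (VRep P F) L = 0 := by
  classical
  refine ContinuousLinearMap.ext_on (s := Set.range (stdBasis (XIndex P F))) ?_ ?_
  · rw [Submodule.dense_iff_topologicalClosure_eq_top]
    exact (stdBasis _).dense_span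
  · rintro _ ⟨x, rfl⟩
    rw [word_VRep_basis_of_degree_eq_one F hL]
    simp [h]

/-! ### Elements of the covariance ideal coming from equal or empty ideals. -/

theorem word_mem_fixedPoints {L : List (P × P)} (hL : degree L = 1) :
    word (CIso.gen P) L ∈ CIso.fixedPoints P :=
  Submodule.le_topologicalClosure _ (Submodule.subset_span ⟨L, hL, rfl⟩)

/-- Here `‖f‖_F` is zero for every `F`, so the limit is trivial; only this part of `I_e` is needed
for constructibility. -/
theorem mem_covIdeal_of_Phi_eq_zero {f : CIso P} (hf : f ∈ CIso.fixedPoints P)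
    (h : ∀ F, Phi P F f = 0) : f ∈ covIdeal P := by
  refine ⟨hf, ?_⟩
  simp [normF, h]

theorem word_sub_word_mem_covIdeal {L M : List (P × P)} (hL : degree L = 1) (hM : degree M = 1)
    (h : idealOf (revList L) = idealOf (revList M)) :
    word (CIso.gen P) L - word (CIso.gen P) M ∈ covIdeal P :=
  mem_covIdeal_of_Phi_eq_zero
    (Submodule.sub_mem _ (word_mem_fixedPoints hL) (word_mem_fixedPoints hM)) fun F => by
    rw [map_sub, Phi_word, Phi_word, word_VRep_eq_of_idealOf_eq F hL hM h, sub_self]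

theorem word_mem_covIdeal {L : List (P × P)} (hL : degree L = 1)
    (h : idealOf (revList L) = ∅) : word (CIso.gen P) L ∈ covIdeal P :=
  mem_covIdeal_of_Phi_eq_zero (word_mem_fixedPoints hL) fun F => by
    rw [Phi_word, word_VRep_eq_zero_of_idealOf_eq_empty F hL h]

/-! ### Surjectivity of the canonical homomorphisms. -/

theorem CIso.hom_ext {B : Type v} [CStarAlgebra B] {φ ψ : CIso P →⋆ₐ[ℂ] B}
    (h : ∀ p, φ (CIso.gen P p) = ψ (CIso.gen P p)) : φ = ψ := by
  have : φ.comp (UnivCStar.of _) = ψ.comp (UnivCStar.of _) := FreeStar.hom_ext h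
  exact UnivCStar.hom_ext fun a => DFunLike.congr_fun this a

theorem isoToCon_word (L : List (P × P)) :
    isoToCon P (word (CIso.gen P) L) = word (CCon.gen P) L := by
  rw [map_word]
  congr 1
  exact funext fun p => CIso.lift_gen _ p

/-- The projection `e_x` of a nonempty constructible ideal is a word in the isometries. -/
theorem CCon.of_freeE_cIdeal (L : List (P × P)) :
    UnivCStar.of {r | ConRel P r} (freeE P (cIdeal P L))
      = word (CCon.gen P) (L ++ revList L) := by
  have hL : degree (L ++ revList L) = 1 := by
    rw [degree_append, degree_revList, mul_inv_cancel]
  have h := UnivCStar.of_eq_zero (R := {r | ConRel P r}) (ConRel.graded _ hL)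
  -- The list `L ++ revList L` is its own reversal and has the ideal of `L`.
  have hc : cIdeal P (revList (L ++ revList L)) = cIdeal P L :=
    Subtype.ext (by
      change idealOf _ = idealOf L
      rw [revList_append, revList_revList, idealOf_append_revList])
  rw [hc, map_sub, sub_eq_zero, map_word] at h
  exact h.symm

theorem isoToCon_surjective : Function.Surjective (isoToCon P) := by
  refine UnivCStar.surjective_of_range _ fun a => ?_
  refine FreeStar.mem_of_gen (UnivCStar.of _) (isoToCon P).range (fun x => ?_) a
  rcases x with p | ⟨x, ⟨L, rfl⟩ | rfl⟩
  · exact ⟨CIso.gen P p, CIso.lift_gen _ p⟩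
  · exact ⟨_, (isoToCon_word _).trans (CCon.of_freeE_cIdeal L).symm⟩
  · have h : UnivCStar.of {r | ConRel P r} (freeE P (cEmpty P)) = 0 :=
      UnivCStar.of_eq_zero ConRel.empty
    exact ⟨0, (map_zero _).trans h.symm⟩

theorem isoToSc_surjective : Function.Surjective (isoToSc P) :=
  UnivCStar.surjective_of_range _ fun a => ⟨a, rfl⟩

/-! ### Strongly covariant representations satisfy the constructible relations. -/

section Constructible

variable {B : Type v} [CStarAlgebra B] (T : IsometricRep P B)

theorem lift_word (L : List (P × P)) : CIso.lift T (word (CIso.gen P) L) = word T L := by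
  rw [map_word]
  congr 1
  exact funext fun p => CIso.lift_gen _ p

open Classical in
/-- The image of `e_x` under an isometric representation `T`: the word of any list of degree one
whose reversed list has ideal `x`, and `0` if there is none. -/
def idealProj (x : Set P) : B :=
  if h : ∃ L : List (P × P), degree L = 1 ∧ idealOf (revList L) = x then word T h.choose else 0

variable {T}

/-- Independence of the chosen list: two degree-one words with the same ideal differ by an element
of `I_e`, which `T` annihilates. -/
theorem IsometricRep.IsStronglyCovariant.idealProj_idealOf (hT : T.IsStronglyCovariant)
    {L : List (P × P)} (hL : degree L = 1) : idealProj T (idealOf (revList L)) = word T L := by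
  have h : ∃ M : List (P × P), degree M = 1 ∧ idealOf (revList M) = idealOf (revList L) :=
    ⟨L, hL, rfl⟩
  have h0 := hT _ (word_sub_word_mem_covIdeal h.choose_spec.1 hL h.choose_spec.2)
  rw [map_sub, lift_word, lift_word, sub_eq_zero] at h0
  rw [idealProj, dif_pos h, h0]

theorem IsometricRep.IsStronglyCovariant.idealProj_empty (hT : T.IsStronglyCovariant) :
    idealProj T (∅ : Set P) = 0 := by
  by_cases h : ∃ L : List (P × P), degree L = 1 ∧ idealOf (revList L) = ∅
  · obtain ⟨L, hL, hL'⟩ := h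
    rw [← hL', hT.idealProj_idealOf hL, ← lift_word]
    exact hT _ (word_mem_covIdeal hL hL')
  -- The empty set need not be the ideal of any list; the default value 0 is then the one required
  -- by `e_∅ = 0`.
  · rw [idealProj, dif_neg h]

/-- The adjoint of a word is the word of the reversed list, which in degree one has the same ideal.
-/
theorem IsometricRep.IsStronglyCovariant.isSelfAdjoint_idealProj (hT : T.IsStronglyCovariant)
    (x : Set P) : star (idealProj T x) = idealProj T x := by
  by_cases h : ∃ L : List (P × P), degree L = 1 ∧ idealOf (revList L) = x
  · obtain ⟨L, hL, rfl⟩ := h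
    have hL' : degree (revList L) = 1 := by rw [degree_revList, hL, inv_one]
    rw [hT.idealProj_idealOf hL, star_word, ← hT.idealProj_idealOf hL', idealOf_revList hL',
      hT.idealProj_idealOf hL]
  · rw [idealProj, dif_neg h, star_zero]

/-- Squaring a word doubles its list, and in degree one concatenation intersects ideals, so the
ideal is unchanged. -/
theorem IsometricRep.IsStronglyCovariant.isIdempotentElem_idealProj
    (hT : T.IsStronglyCovariant) (x : Set P) :
    idealProj T x * idealProj T x = idealProj T x := by
  by_cases h : ∃ L : List (P × P), degree L = 1 ∧ idealOf (revList L) = x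
  · obtain ⟨L, hL, rfl⟩ := h
    have hL' : degree (revList L) = 1 := by rw [degree_revList, hL, inv_one]
    have hLL : degree (L ++ L) = 1 := by rw [degree_append, hL, mul_one]
    rw [hT.idealProj_idealOf hL, ← word_append, ← hT.idealProj_idealOf hLL, revList_append,
      idealOf_append hL', Set.inter_self, hT.idealProj_idealOf hL]
  · rw [idealProj, dif_neg h, mul_zero]

/-- Strongly covariant representations are constructible. -/
theorem IsometricRep.IsStronglyCovariant.isConstructible (hT : T.IsStronglyCovariant) :
    T.IsConstructible := by
  set φ : FreeStar (P ⊕ ConstructibleIdeals P) →⋆ₐ[ℂ] B :=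
    FreeStar.lift (Sum.elim T fun x => idealProj T x.1)
  have hV : ∀ p, φ (freeV P p) = T p := fun p => FreeStar.lift_gen _ _
  have hE : ∀ x, φ (freeE P x) = idealProj T x.1 := fun x => FreeStar.lift_gen _ _
  have hrel : ∀ r ∈ {r | ConRel P r}, φ r = 0 := by
    rintro _ (p | x | x | ⟨p, q⟩ | _ | ⟨L, hL⟩)
    · rw [map_sub, _root_.map_mul, map_star, map_one, hV, T.isometry, sub_self]
    · rw [map_sub, map_star, hE, hT.isSelfAdjoint_idealProj, sub_self]
    · rw [map_sub, _root_.map_mul, hE, hT.isIdempotentElem_idealProj, sub_self]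
    · rw [map_sub, _root_.map_mul, hV, hV, hV, T.map_mul, sub_self]
    · rw [hE]
      exact hT.idealProj_empty
    · rw [map_sub, map_word, hE, sub_eq_zero]
      simp only [hV]
      exact (hT.idealProj_idealOf hL).symm
  exact ⟨UnivCStar.lift φ hrel, fun p => (UnivCStar.lift_of φ hrel _).trans (hV p)⟩

end Constructible

/-! ### The universal strongly covariant representation and the factorization. -/

variable (P) in
/-- The canonical isometric representation of `P` in the strong covariance algebra. -/
def CSc.gen : IsometricRep P (CSc P) where
  toFun p := isoToSc P (CIso.gen P p)
  isometry p := by rw [← map_star, ← _root_.map_mul, (CIso.gen P).isometry, map_one]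
  map_mul p q := by rw [(CIso.gen P).map_mul, _root_.map_mul]

theorem CSc.lift_gen : CIso.lift (CSc.gen P) = isoToSc P :=
  CIso.hom_ext fun p => CIso.lift_gen _ p

theorem CSc.isStronglyCovariant_gen : (CSc.gen P).IsStronglyCovariant := fun f hf => by
  rw [CSc.lift_gen]
  exact UnivCStar.of_eq_zero hf

end Semigroup
end SemigroupCStar
end

theorem proposition3p4 {G : Type*} [Group G] (P : Submonoid G) :
    (Function.Surjective (SemigroupCStar.isoToCon P) ∧
      Function.Surjective (SemigroupCStar.isoToSc P) ∧
      ∃! π : SemigroupCStar.CCon P →⋆ₐ[ℂ] SemigroupCStar.CSc P,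
        π.comp (SemigroupCStar.isoToCon P) = SemigroupCStar.isoToSc P) ∧
    ∀ (B : Type*) [CStarAlgebra B] (T : SemigroupCStar.IsometricRep P B),
      T.IsStronglyCovariant → T.IsConstructible := by
  open SemigroupCStar in
  refine ⟨⟨isoToCon_surjective, isoToSc_surjective, ?_⟩, fun B _ T hT => hT.isConstructible⟩
  -- The factorization is the constructibility of the tautological representation in `C*_sc(P)`.
  obtain ⟨π, hπ⟩ := (CSc.isStronglyCovariant_gen (P := P)).isConstructible
  have hπ' : π.comp (isoToCon P) = isoToSc P := CIso.hom_ext fun p => by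
    rw [StarAlgHom.comp_apply, isoToCon, CIso.lift_gen]
    exact hπ p
  refine ⟨π, hπ', fun ρ hρ => StarAlgHom.ext fun x => ?_⟩
  -- Surjectivity of `isoToCon` makes it an epimorphism, which gives uniqueness.
  obtain ⟨a, rfl⟩ := isoToCon_surjective x
  exact DFunLike.congr_fun (hρ.trans hπ'.symm) a
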